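/- **Setting.** The Shrikhande graph is the Cayley graph of $\mathbb{Z}_4^2$ with connecting set $\{(0,1),(0,3),(1,0),(3,0),(1,1),(3,3)\}$. For integers $m,n\ge 0$, $D(m,n)$ denotes the Cartesian product of $m$ copies of the Shrikhande graph and $n$ copies of the complete graph $K_4$. A perfect coloring of a graph with quotient matrix $S=(s_{ij})_{i,j\in\{1,2\}}$ is a surjective map $f$ from its vertex set onto $\{1,2\}$ such that, for all $i,j\in\{1,2\}$, every vertex of color $i$ has exactly $s_{ij}$ neighbors of color $j$. **Theorem.** Let $b,c$ be positive integers, let $g=\gcd(b,c)$, and suppose that $g\ge 2$ and $(b+c)/g=4^l$ for some integer $l\ge 0$. Then: 1. For all integers $m,n\ge 0$ with $2m+n=\dfrac{g\,(4^l-1)}{3}$, the graph $D(m,n)$ has a perfect coloring with quotient matrix $$\begin{pmatrix} c-g & b\\ c & b-g\end{pmatrix}.$$ 2. If $g$ is odd, then the number $\dfrac{g\,(4^l-1)+3}{3}$ is an even integer and, for the integer $m$ with $2m=\dfrac{g\,(4^l-1)+3}{3}$, the graph $D(m,0)$ has a perfect coloring with quotient matrix $$\begin{pmatrix} c-g+3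 & b\\ c & b-g+3\end{pmatrix}.$$ -/

import Mathlib

/-- The Shrikhande graph: the Cayley graph of `(ℤ/4ℤ)²` with connecting set
`{01, 03, 10, 30, 11, 33}`. -/
def shrikhandeGraph : SimpleGraph (ZMod 4 × ZMod 4) :=
  SimpleGraph.addCayley {(0, 1), (0, 3), (1, 0), (3, 0), (1, 1), (3, 3)}

/-- The Cartesian power `G □ ⋯ □ G` of a graph, with factors indexed by `ι`: two tuples are
adjacent iff they differ in exactly one coordinate, and their entries there are adjacent
in `G`. -/
def SimpleGraph.boxPower {V : Type*} (G : SimpleGraph V) (ι : Type*) :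
    SimpleGraph (ι → V) where
  Adj x y := ∃ i, G.Adj (x i) (y i) ∧ ∀ j, j ≠ i → x j = y j
  symm := by
    constructor
    rintro x y ⟨i, hi, h⟩
    exact ⟨i, hi.symm, fun j hj => (h j hj).symm⟩
  loopless := by
    constructor
    rintro x ⟨i, hi, -⟩
    exact hi.ne rfl

/-- The graph `D(m, n)`: the Cartesian product of `m` copies of the Shrikhande graph and `n`
copies of the complete graph on four vertices. -/
def doobGraph (m n : ℕ) :
    SimpleGraph ((Fin m → ZMod 4 × ZMod 4) × (Fin n → ZMod 4)) :=
  (shrikhandeGraph.boxPower (Fin m)).boxProd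
    ((⊤ : SimpleGraph (ZMod 4)).boxPower (Fin n))

/-- `f` is a perfect coloring of the finite graph `G` with color set `K` and quotient matrix
`S`: it is onto `K`, and every vertex of color `i` has exactly `S i j` neighbors of color `j`,
for all colors `i`, `j`. -/
def IsPerfectColoring {V K : Type*} [Finite V] (G : SimpleGraph V) (f : V → K)
    (S : Matrix K K ℕ) : Prop :=
  Function.Surjective f ∧
    ∀ (i j : K) (x : V), f x = i → {y : V | G.Adj x y ∧ f y = j}.ncard = S i j

/-! Write `b = g q` and `c = g p`, so that `p + q = 4 ^ l`. It suffices to color with `4 ^ l` colors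
so that each vertex has `d` neighbors of its own color and `g` of every other color, with `d = 0` or
`d = 3`: merging `p` of the colors against the other `q` gives the two matrices
(`HasEquitableColoring.exists_isPerfectColoring`).

The colors are vectors over the field of order four, and `l` grows by one through
`hasEquitableColoring_succ`: one group of factors supplies every step that changes a new coordinate,
`g` times each, and the remaining factors supply the steps that fix it. For the first group, the
lines through `(1, c)` partition the vectors with nonzero first coordinate. A `K₄` factor mapped
onto a line covers its nonzero points once, a Shrikhande factor covers them twice. Hence odd `g`
requires many `K₄` factors (`hasCayleyColoring_quadSteps`). When they are scarce, a pair of digits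
is replaced by `ℤ₄²`, where Shrikhande factors alone can cover each required step once
(`hasCayleyColoring_orderFour`). -/

open Finset Function

/-! ### Counting neighbors in Cartesian products. -/

/-- Neighbors of a vertex of a Cartesian power, counted coordinate by coordinate. -/
lemma SimpleGraph.ncard_boxPower_adj {V ι : Type*} [Finite V] [Fintype ι] [DecidableEq ι]
    (G : SimpleGraph V) (x : ι → V) (P : (ι → V) → Prop) :
    {y | (G.boxPower ι).Adj x y ∧ P y}.ncard =
      ∑ i, {z | G.Adj (x i) z ∧ P (update x i z)}.ncard := by
  simp only [← Nat.card_coe_set_eq]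
  rw [← Nat.card_sigma]
  symm
  refine Nat.card_eq_of_bijective (fun p => ⟨update x p.1 p.2.1, ⟨p.1, ?_, ?_⟩, p.2.2.2⟩)
    ⟨?_, ?_⟩
  · simpa using p.2.2.1
  · intro j hj
    simp [hj]
  · rintro ⟨i, z, hz⟩ ⟨j, w, hw⟩ h
    have h' : update x i z = update x j w := congrArg Subtype.val h
    have hij : i = j := by
      by_contra hne
      have := congrFun h' i
      rw [update_self, update_of_ne hne] at this
      exact hz.1.ne this.symm
    subst hij
    have : z = w := by simpa using congrFun h' i
    subst this
    rfl
  · rintro ⟨y, ⟨i, hi, h⟩, hP⟩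
    have hy : update x i (y i) = y := by
      funext j
      by_cases hj : j = i
      · subst hj; simp
      · simp [hj, h j hj]
    exact ⟨⟨i, y i, hi, by rwa [hy]⟩, Subtype.ext hy⟩

/-- Neighbors of a vertex of a Cartesian product, counted factor by factor. -/
lemma SimpleGraph.ncard_boxProd_adj {V W : Type*} [Finite V] [Finite W]
    (G : SimpleGraph V) (H : SimpleGraph W) (x : V × W) (P : V × W → Prop) :
    {y | (G.boxProd H).Adj x y ∧ P y}.ncard =
      {z | G.Adj x.1 z ∧ P (z, x.2)}.ncard + {z | H.Adj x.2 z ∧ P (x.1, z)}.ncard := by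
  have h : {y | (G.boxProd H).Adj x y ∧ P y} =
      (fun z => (z, x.2)) '' {z | G.Adj x.1 z ∧ P (z, x.2)} ∪
        (fun z => (x.1, z)) '' {z | H.Adj x.2 z ∧ P (x.1, z)} := by
    ext ⟨y, w⟩
    simp only [Set.mem_ofPred_eq, SimpleGraph.boxProd_adj, Set.mem_union, Set.mem_image,
      Prod.mk.injEq]
    constructor
    · rintro ⟨⟨h1, h2⟩ | ⟨h1, h2⟩, h3⟩
      · exact Or.inl ⟨y, ⟨h1, by rwa [h2]⟩, rfl, h2⟩
      · exact Or.inr ⟨w, ⟨h1, by rwa [h2]⟩, h2, rfl⟩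
    · rintro (⟨z, ⟨h1, h2⟩, rfl, rfl⟩ | ⟨z, ⟨h1, h2⟩, rfl, rfl⟩)
      · exact ⟨Or.inl ⟨h1, rfl⟩, h2⟩
      · exact ⟨Or.inr ⟨h1, rfl⟩, h2⟩
  rw [h, Set.ncard_union_eq ?_ (Set.toFinite _) (Set.toFinite _),
    Set.ncard_image_of_injective _ (fun a b hab => congrArg Prod.fst hab),
    Set.ncard_image_of_injective _ (fun a b hab => congrArg Prod.snd hab)]
  rw [Set.disjoint_left]
  rintro _ ⟨z, ⟨h1, -⟩, rfl⟩ ⟨w, ⟨h2, -⟩, h3⟩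
  exact h1.ne (congrArg Prod.fst h3)

/-- The vertices of `D(m, n)`. -/
abbrev DoobVertex (m n : ℕ) : Type := (Fin m → ZMod 4 × ZMod 4) × (Fin n → ZMod 4)

lemma ncard_doobGraph_adj {m n : ℕ} (v : DoobVertex m n) (P : DoobVertex m n → Prop) :
    {y | (doobGraph m n).Adj v y ∧ P y}.ncard =
      ∑ i, {z | shrikhandeGraph.Adj (v.1 i) z ∧ P (update v.1 i z, v.2)}.ncard +
        ∑ i, {z | v.2 i ≠ z ∧ P (v.1, update v.2 i z)}.ncard := by
  rw [doobGraph, SimpleGraph.ncard_boxProd_adj,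
    SimpleGraph.ncard_boxPower_adj shrikhandeGraph v.1 (fun z => P (z, v.2)),
    SimpleGraph.ncard_boxPower_adj ⊤ v.2 (fun z => P (v.1, z))]
  rfl

/-- The restriction of a vertex of `D(m₁ + m₂, n₁ + n₂)` to the first factors. -/
def DoobVertex.left {m₁ n₁ m₂ n₂ : ℕ} (v : DoobVertex (m₁ + m₂) (n₁ + n₂)) :
    DoobVertex m₁ n₁ :=
  (v.1 ∘ Fin.castAdd m₂, v.2 ∘ Fin.castAdd n₂)

/-- The restriction of a vertex of `D(m₁ + m₂, n₁ + n₂)` to the last factors. -/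
def DoobVertex.right {m₁ n₁ m₂ n₂ : ℕ} (v : DoobVertex (m₁ + m₂) (n₁ + n₂)) :
    DoobVertex m₂ n₂ :=
  (v.1 ∘ Fin.natAdd m₁, v.2 ∘ Fin.natAdd n₁)

lemma update_castAdd_comp_castAdd {α : Type*} {m n : ℕ} (v : Fin (m + n) → α) (i : Fin m)
    (z : α) : update v (Fin.castAdd n i) z ∘ Fin.castAdd n = update (v ∘ Fin.castAdd n) i z :=
  update_comp_eq_of_injective v (Fin.castAdd_injective m n) i z

lemma update_natAdd_comp_natAdd {α : Type*} {m n : ℕ} (v : Fin (m + n) → α) (i : Fin n)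
    (z : α) : update v (Fin.natAdd m i) z ∘ Fin.natAdd m = update (v ∘ Fin.natAdd m) i z :=
  update_comp_eq_of_injective v (Fin.natAdd_injective n m) i z

lemma update_castAdd_comp_natAdd {α : Type*} {m n : ℕ} (v : Fin (m + n) → α) (i : Fin m)
    (z : α) : update v (Fin.castAdd n i) z ∘ Fin.natAdd m = v ∘ Fin.natAdd m := by
  refine update_comp_eq_of_notMem_range _ _ ?_
  rintro ⟨j, hj⟩
  simp only [Fin.ext_iff, Fin.val_natAdd, Fin.val_castAdd] at hj
  omega

lemma update_natAdd_comp_castAdd {α : Type*} {m n : ℕ} (v : Fin (m + n) → α) (i : Fin n)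
    (z : α) : update v (Fin.natAdd m i) z ∘ Fin.castAdd n = v ∘ Fin.castAdd n := by
  refine update_comp_eq_of_notMem_range _ _ ?_
  rintro ⟨j, hj⟩
  simp only [Fin.ext_iff, Fin.val_natAdd, Fin.val_castAdd] at hj
  omega

/-- `D(m₁ + m₂, n₁ + n₂)` is the Cartesian product of `D(m₁, n₁)` and `D(m₂, n₂)`: neighbors
are counted factor by factor. -/
lemma ncard_doobGraph_add_adj {m₁ n₁ m₂ n₂ : ℕ} (v : DoobVertex (m₁ + m₂) (n₁ + n₂))
    (P : DoobVertex m₁ n₁ → DoobVertex m₂ n₂ → Prop) :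
    {y | (doobGraph (m₁ + m₂) (n₁ + n₂)).Adj v y ∧
        P (DoobVertex.left y) (DoobVertex.right y)}.ncard =
      {y | (doobGraph m₁ n₁).Adj v.left y ∧ P y v.right}.ncard +
        {y | (doobGraph m₂ n₂).Adj v.right y ∧ P v.left y}.ncard := by
  rw [ncard_doobGraph_adj v (fun y => P (DoobVertex.left y) (DoobVertex.right y)),
    ncard_doobGraph_adj v.left (fun y => P y v.right),
    ncard_doobGraph_adj v.right (fun y => P v.left y), Fin.sum_univ_add, Fin.sum_univ_add]
  simp only [DoobVertex.left, DoobVertex.right, update_castAdd_comp_castAdd,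
    update_natAdd_comp_natAdd, update_castAdd_comp_natAdd, update_natAdd_comp_castAdd,
    Function.comp_apply]
  ring

/-! ### Equitable colorings and their products. -/

/-- `D(m, n)` has a coloring by `X`, not necessarily onto, in which every vertex of color `i`
has exactly `M i j` neighbors of color `j`. -/
def HasEquitableColoring (m n : ℕ) {X : Type*} (M : X → X → ℕ) : Prop :=
  ∃ f : DoobVertex m n → X, ∀ v j, {y | (doobGraph m n).Adj v y ∧ f y = j}.ncard = M (f v) j

lemma ncard_adj_and_comp {V X : Type*} [Finite V] [Fintype X] (G : SimpleGraph V)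
    (f : V → X) (v : V) (P : X → Prop) [DecidablePred P] :
    {y | G.Adj v y ∧ P (f y)}.ncard =
      ∑ j, if P j then {y | G.Adj v y ∧ f y = j}.ncard else 0 := by
  classical
  have := Fintype.ofFinite V
  rw [← Finset.sum_filter]
  simp only [Set.ncard_eq_toFinset_card', Set.toFinset_ofPred]
  rw [Finset.card_eq_sum_card_fiberwise (f := f) (t := univ.filter P)]
  · refine Finset.sum_congr rfl fun j hj => ?_
    congr 1
    ext y
    simp only [mem_filter, mem_univ, true_and] at hj ⊢
    constructor
    · rintro ⟨⟨h1, -⟩, h2⟩; exact ⟨h1, h2⟩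
    · rintro ⟨h1, rfl⟩; exact ⟨⟨h1, hj⟩, rfl⟩
  · intro y hy
    simp only [coe_filter, mem_univ, true_and, Set.mem_ofPred_eq] at hy ⊢
    exact hy.2

lemma HasEquitableColoring.combine {m₁ n₁ m₂ n₂ : ℕ} {X Y Z : Type*} [Fintype X] [Fintype Y]
    [DecidableEq Z] {M₁ : X → X → ℕ} {M₂ : Y → Y → ℕ} {M : Z → Z → ℕ}
    (h₁ : HasEquitableColoring m₁ n₁ M₁) (h₂ : HasEquitableColoring m₂ n₂ M₂)
    (op : X → Y → Z)
    (h : ∀ x y z, (∑ x', if op x' y = z then M₁ x x' else 0) +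
      (∑ y', if op x y' = z then M₂ y y' else 0) = M (op x y) z) :
    HasEquitableColoring (m₁ + m₂) (n₁ + n₂) M := by
  obtain ⟨f₁, h₁⟩ := h₁
  obtain ⟨f₂, h₂⟩ := h₂
  refine ⟨fun v => op (f₁ (DoobVertex.left v)) (f₂ (DoobVertex.right v)), fun v z => ?_⟩
  rw [ncard_doobGraph_add_adj v (fun a b => op (f₁ a) (f₂ b) = z),
    ncard_adj_and_comp _ f₁ _ (fun x' => op x' (f₂ (DoobVertex.right v)) = z),
    ncard_adj_and_comp _ f₂ _ (fun y' => op (f₁ (DoobVertex.left v)) y' = z), ← h]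
  simp only [h₁, h₂]

lemma HasEquitableColoring.congr_equiv {m n : ℕ} {X Y : Type*} {M : X → X → ℕ}
    {M' : Y → Y → ℕ} (h : HasEquitableColoring m n M) (e : X ≃ Y)
    (hM : ∀ x x', M x x' = M' (e x) (e x')) : HasEquitableColoring m n M' := by
  obtain ⟨f, hf⟩ := h
  refine ⟨fun v => e (f v), fun v j => ?_⟩
  rw [← e.apply_symm_apply j, ← hM, ← hf]
  simp only [e.apply_eq_iff_eq]

lemma HasEquitableColoring.mono_eq {m n m' n' : ℕ} {X : Type*} {M M' : X → X → ℕ}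
    (h : HasEquitableColoring m n M) (hm : m = m') (hn : n = n')
    (hM : ∀ x x', M x x' = M' x x') : HasEquitableColoring m' n' M' := by
  subst hm hn
  exact h.congr_equiv (Equiv.refl X) hM

/-- An equitable coloring by an abelian group whose quotient matrix is translation invariant. -/
def HasCayleyColoring (m n : ℕ) {A : Type*} [AddCommGroup A] (μ : A → ℕ) : Prop :=
  HasEquitableColoring m n fun x y : A => μ (y - x)

/-- Adding the two colors turns a step in either factor into the same translation of the sum, so
step multiplicities add. -/
lemma HasCayleyColoring.add {m₁ n₁ m₂ n₂ : ℕ} {A : Type*} [AddCommGroup A] [Fintype A]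
    {μ₁ μ₂ : A → ℕ} (h₁ : HasCayleyColoring m₁ n₁ μ₁) (h₂ : HasCayleyColoring m₂ n₂ μ₂) :
    HasCayleyColoring (m₁ + m₂) (n₁ + n₂) (μ₁ + μ₂) := by
  classical
  refine HasEquitableColoring.combine h₁ h₂ (· + ·) fun x y z => ?_
  have e₁ : ∀ x', x' + y = z ↔ x' = z - y := fun _ => eq_sub_iff_add_eq.symm
  have e₂ : ∀ y', x + y' = z ↔ y' = z - x := fun _ => eq_sub_iff_add_eq'.symm
  simp only [e₁, e₂, Finset.sum_ite_eq', mem_univ, if_true, Pi.add_apply]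
  congr 2 <;> abel

lemma hasCayleyColoring_zero {A : Type*} [AddCommGroup A] :
    HasCayleyColoring 0 0 (0 : A → ℕ) :=
  ⟨fun _ => 0, fun v j => by rw [ncard_doobGraph_adj v (fun _ => (0 : A) = j)]; simp⟩

lemma hasCayleyColoring_sum {A C : Type*} [AddCommGroup A] [Fintype A] (s : Finset C)
    (m n : C → ℕ) (μ : C → A → ℕ) (h : ∀ c ∈ s, HasCayleyColoring (m c) (n c) (μ c)) :
    HasCayleyColoring (∑ c ∈ s, m c) (∑ c ∈ s, n c) (∑ c ∈ s, μ c) := by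
  classical
  induction s using Finset.induction_on with
  | empty => simpa using hasCayleyColoring_zero
  | insert a s ha ih =>
    rw [sum_insert ha, sum_insert ha, sum_insert ha]
    exact (h a (mem_insert_self a s)).add (ih fun c hc => h c (mem_insert_of_mem hc))

/-! ### Both factors as Cayley graphs, colored by homomorphisms. -/

/-- The connecting set of the Shrikhande graph. -/
def shrikhandeSteps : Finset (ZMod 4 × ZMod 4) :=
  {(0, 1), (0, 3), (1, 0), (3, 0), (1, 1), (3, 3)}

lemma shrikhandeGraph_adj (x y : ZMod 4 × ZMod 4) :
    shrikhandeGraph.Adj x y ↔ y - x ∈ shrikhandeSteps := by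
  -- The connecting set is symmetric and omits zero, so symmetrizing it and removing loops changes
  -- nothing.
  have h : ∀ d : ZMod 4 × ZMod 4, d ∈ shrikhandeSteps ↔
      d ≠ 0 ∧ (d ∈ shrikhandeSteps ∨ -d ∈ shrikhandeSteps) := by decide
  rw [shrikhandeGraph, SimpleGraph.addCayley_adj', h, sub_ne_zero, ne_comm]
  refine and_congr_right fun _ => ?_
  have hS : ∀ d : ZMod 4 × ZMod 4, d ∈ ({(0, 1), (0, 3), (1, 0), (3, 0), (1, 1), (3, 3)} :
      Set (ZMod 4 × ZMod 4)) ↔ d ∈ shrikhandeSteps := fun d => by simp [shrikhandeSteps]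
  simp only [hS]
  constructor
  · rintro ⟨e, he, rfl | rfl⟩
    · exact Or.inl (by simpa using he)
    · exact Or.inr (by simpa using he)
  · rintro (h | h)
    · exact ⟨_, h, Or.inl (by simp)⟩
    · exact ⟨_, h, Or.inr (by simp)⟩

lemma ncard_shrikhandeGraph_adj (x : ZMod 4 × ZMod 4) (P : ZMod 4 × ZMod 4 → Prop)
    [DecidablePred P] :
    {z | shrikhandeGraph.Adj x z ∧ P z}.ncard =
      ∑ e ∈ shrikhandeSteps, if P (x + e) then 1 else 0 := by
  rw [← Finset.card_filter, ← Finset.card_map (addLeftEmbedding x), ← Set.ncard_coe_finset]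
  congr 1
  ext z
  simp only [shrikhandeGraph_adj, coe_map, coe_filter, Set.mem_ofPred_eq, Set.mem_image,
    addLeftEmbedding_apply]
  constructor
  · rintro ⟨h1, h2⟩
    exact ⟨z - x, ⟨h1, by simpa using h2⟩, by simp⟩
  · rintro ⟨e, ⟨h1, h2⟩, rfl⟩
    exact ⟨by simpa using h1, h2⟩

lemma hasCayleyColoring_shrikhande {A : Type*} [AddCommGroup A] [DecidableEq A]
    (φ : ZMod 4 × ZMod 4 →+ A) :
    HasCayleyColoring 1 0 fun d => ∑ e ∈ shrikhandeSteps, if φ e = d then 1 else 0 := by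
  refine ⟨fun v => φ (v.1 0), fun v j => ?_⟩
  rw [ncard_doobGraph_adj v (fun y => φ (y.1 0) = j)]
  simp [ncard_shrikhandeGraph_adj, eq_sub_iff_add_eq']

/-- The elements of the field of order four, in the basis `1, ω`. -/
abbrev Quad : Type := ZMod 2 × ZMod 2

lemma hasCayleyColoring_completeGraph {A : Type*} [AddCommGroup A] [DecidableEq A]
    (η : Quad →+ A) :
    HasCayleyColoring 0 1 fun d => ∑ e : Quad, if e ≠ 0 ∧ η e = d then 1 else 0 := by
  have hcard : Fintype.card (ZMod 4) = Fintype.card Quad := rfl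
  -- Any bijection serves: in a complete graph all nonzero differences are steps.
  let β : ZMod 4 ≃ Quad := Fintype.equivOfCardEq hcard
  refine ⟨fun v => η (β (v.2 0)), fun v j => ?_⟩
  rw [ncard_doobGraph_adj v (fun y => η (β (y.2 0)) = j)]
  simp only [univ_eq_empty, sum_empty, zero_add, univ_unique, Fin.default_eq_zero, Fin.isValue,
    sum_singleton, update_self, Set.ncard_eq_toFinset_card', Set.toFinset_ofPred]
  rw [Finset.card_filter]
  refine Fintype.sum_equiv (β.trans (Equiv.subRight (β (v.2 0)))) _ _ fun z => ?_
  have e₁ : β z - β (v.2 0) = 0 ↔ v.2 0 = z := by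
    rw [sub_eq_zero, β.apply_eq_iff_eq, eq_comm]
  simp [e₁, eq_sub_iff_add_eq]

/-! ### Covering steps by lines over the field of order four. -/

/-- Multiplication in the field of order four. -/
def Quad.mul (s a : Quad) : Quad := (s.1 * a.1 + s.2 * a.2, s.1 * a.2 + s.2 * a.1 + s.2 * a.2)

lemma Quad.add_mul (s t a : Quad) : Quad.mul (s + t) a = Quad.mul s a + Quad.mul t a := by
  simp only [Quad.mul, Prod.fst_add, Prod.snd_add, Prod.mk_add_mk]
  congr 1 <;> ring

lemma Quad.mul_bijective : ∀ s : Quad, s ≠ 0 → Bijective (Quad.mul s) := by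
  decide

/-- Vectors over the field of order four. -/
abbrev QuadVec (k : ℕ) : Type := Fin k → Quad

/-- Scalar multiplication on `QuadVec k`. -/
def QuadVec.smul {k : ℕ} (s : Quad) (c : QuadVec k) : QuadVec k := fun i => Quad.mul s (c i)

lemma QuadVec.add_smul {k : ℕ} (s t : Quad) (c : QuadVec k) :
    QuadVec.smul (s + t) c = QuadVec.smul s c + QuadVec.smul t c :=
  funext fun _ => Quad.add_mul _ _ _

lemma QuadVec.smul_bijective {k : ℕ} {s : Quad} (hs : s ≠ 0) :
    Bijective (QuadVec.smul s : QuadVec k → QuadVec k) :=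
  Bijective.piMap fun _ => Quad.mul_bijective s hs

lemma QuadVec.card (k : ℕ) : Fintype.card (QuadVec k) = 4 ^ k := by simp

lemma QuadVec.sum_smul_eq {k : ℕ} {s : Quad} (hs : s ≠ 0) (v : QuadVec k) :
    (∑ c : QuadVec k, if QuadVec.smul s c = v then 1 else 0) = 1 := by
  obtain ⟨c, rfl⟩ := (QuadVec.smul_bijective hs).2 v
  simp [(QuadVec.smul_bijective hs).1.eq_iff]

/-- The line through `(1, c)`. -/
def QuadVec.line {k : ℕ} (c : QuadVec k) : Quad →+ Quad × QuadVec k :=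
  AddMonoidHom.mk' (fun s => (s, QuadVec.smul s c)) fun s t => by
    rw [QuadVec.add_smul]; rfl

/-- Reduction modulo two. -/
def quadOfZMod4 : ZMod 4 × ZMod 4 →+ Quad :=
  ((ZMod.castHom (by decide : 2 ∣ 4) (ZMod 2)).toAddMonoidHom).prodMap
    ((ZMod.castHom (by decide : 2 ∣ 4) (ZMod 2)).toAddMonoidHom)

/-- The number of times that the line through `(1, c)` covers a nonzero point. -/
def QuadVec.lineCount {k : ℕ} (c : QuadVec k) (d : Quad × QuadVec k) : ℕ :=
  ∑ e : Quad, if e ≠ 0 ∧ QuadVec.line c e = d then 1 else 0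

/-- The six steps come in pairs `±e`, which agree modulo two; the three pairs give the three nonzero
elements. -/
lemma sum_shrikhandeSteps_quad (F : Quad → ℕ) :
    ∑ e ∈ shrikhandeSteps, F (quadOfZMod4 e) = 2 * ∑ e : Quad, if e ≠ 0 then F e else 0 := by
  have h1 : ∑ e ∈ shrikhandeSteps, F (quadOfZMod4 e) =
      F (0, 1) + (F (0, 1) + (F (1, 0) + (F (1, 0) + (F (1, 1) + F (1, 1))))) := rfl
  have h2 : (∑ e : Quad, if e ≠ 0 then F e else 0) = F (0, 1) + F (1, 0) + F (1, 1) := by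
    rw [Fintype.sum_prod_type]
    simp [show (univ : Finset (ZMod 2)) = {0, 1} from rfl, add_assoc]
  rw [h1, h2]
  ring

lemma hasCayleyColoring_line_double {k : ℕ} (c : QuadVec k) :
    HasCayleyColoring 1 0 (2 * QuadVec.lineCount c) := by
  have h := hasCayleyColoring_shrikhande ((QuadVec.line c).comp quadOfZMod4)
  convert h using 2 with d
  simp only [AddMonoidHom.comp_apply]
  rw [sum_shrikhandeSteps_quad fun e => if QuadVec.line c e = d then 1 else 0]
  simp [QuadVec.lineCount, ite_and]

lemma hasCayleyColoring_line {k : ℕ} (c : QuadVec k) :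
    HasCayleyColoring 0 1 (QuadVec.lineCount c) :=
  hasCayleyColoring_completeGraph (QuadVec.line c)

/-- A point `(s, v)` with `s ≠ 0` lies on the line through `(1, c)` only for `c = s⁻¹ v`. -/
lemma QuadVec.sum_lineCount {k : ℕ} :
    ∑ c : QuadVec k, QuadVec.lineCount c = fun d => if d.1 = 0 then 0 else 1 := by
  funext ⟨s, v⟩
  simp only [Finset.sum_apply, QuadVec.lineCount]
  rw [Finset.sum_comm, Finset.sum_eq_single s]
  · by_cases hs : s = 0
    · simp [hs]
    · have := QuadVec.sum_smul_eq hs v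
      simpa [hs, QuadVec.line] using this
  · intro t _ hts
    refine Finset.sum_eq_zero fun c _ => if_neg ?_
    rintro ⟨-, h⟩
    exact hts (congrArg Prod.fst h)
  · simp

/-- Every step changing the first coordinate counted once. -/
def quadSteps (k : ℕ) (d : Quad × QuadVec k) : ℕ := if d.1 = 0 then 0 else 1

lemma hasCayleyColoring_quadSteps_one (k : ℕ) : HasCayleyColoring 0 (4 ^ k) (quadSteps k) := by
  have h := hasCayleyColoring_sum univ (fun _ : QuadVec k => 0) (fun _ => 1)
    QuadVec.lineCount fun c _ => hasCayleyColoring_line c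
  rw [QuadVec.sum_lineCount] at h
  simpa [QuadVec.card] using! h

lemma hasCayleyColoring_quadSteps_two (k m : ℕ) (hm : m ≤ 4 ^ k) :
    HasCayleyColoring m (2 * (4 ^ k - m)) (2 * quadSteps k) := by
  classical
  obtain ⟨s, -, hs⟩ := exists_subset_card_eq (s := (univ : Finset (QuadVec k))) (n := m)
    (by rwa [card_univ, QuadVec.card])
  have h := hasCayleyColoring_sum univ (fun c : QuadVec k => if c ∈ s then 1 else 0)
    (fun c => if c ∈ s then 0 else 2) (fun c => 2 * QuadVec.lineCount c) fun c _ => by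
      by_cases hc : c ∈ s
      · simpa [hc] using hasCayleyColoring_line_double c
      · simpa [hc, two_mul] using (hasCayleyColoring_line c).add (hasCayleyColoring_line c)
  rw [← mul_sum, QuadVec.sum_lineCount] at h
  have h₁ : (∑ c : QuadVec k, if c ∈ s then 1 else 0) = m := by simp [hs]
  have h₂ : (∑ c : QuadVec k, if c ∈ s then 0 else 2) = 2 * (4 ^ k - m) := by
    rw [← QuadVec.card k, ← hs, ← card_compl, card_eq_sum_ones, mul_sum]
    simp only [mul_one, compl_eq_univ_sdiff, sdiff_eq_filter, sum_filter]
    exact sum_congr rfl fun c _ => by by_cases hc : c ∈ s <;> simp [hc]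
  rw [h₁, h₂] at h
  exact h

/-- Two layers are removed at a time, with as many Shrikhande factors as fit. A last single layer
must consist of `4 ^ k` copies of `K₄`, whence the alternative in the hypothesis. -/
lemma hasCayleyColoring_quadSteps (k : ℕ) : ∀ g m n : ℕ, 2 * m + n = g * 4 ^ k →
    (Even g ∨ 4 ^ k ≤ n) → HasCayleyColoring m n (g • quadSteps k)
  | 0, m, n, h, _ => by
    obtain ⟨rfl, rfl⟩ : m = 0 ∧ n = 0 := by omega
    simpa using hasCayleyColoring_zero
  | 1, m, n, h, hg => by
    have hn : 4 ^ k ≤ n := hg.resolve_left (by decide)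
    obtain ⟨rfl, rfl⟩ : m = 0 ∧ n = 4 ^ k := by omega
    simpa using hasCayleyColoring_quadSteps_one k
  | g + 2, m, n, h, hg => by
    have hg' : (g + 2) * 4 ^ k = g * 4 ^ k + 2 * 4 ^ k := by ring
    have hmu : 2 * quadSteps k + g • quadSteps k = (g + 2) • quadSteps k := by
      rw [add_nsmul, two_nsmul, two_mul, add_comm]
    rw [← hmu]
    rcases le_total m (4 ^ k) with hm | hm
    · have h₁ := hasCayleyColoring_quadSteps_two k m hm
      have h₂ := hasCayleyColoring_quadSteps k g 0 (g * 4 ^ k) (by omega) (by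
        rcases Nat.even_or_odd g with he | ho
        · exact Or.inl he
        · exact Or.inr (Nat.le_mul_of_pos_left _ ho.pos))
      convert h₁.add h₂ using 1 <;> omega
    · have h₁ := hasCayleyColoring_quadSteps_two k (4 ^ k) le_rfl
      have h₂ := hasCayleyColoring_quadSteps k g (m - 4 ^ k) n (by omega)
        (hg.imp_left fun he => by simpa [Nat.even_add] using he)
      convert h₁.add h₂ using 1 <;> omega

/-! ### Covering steps once by Shrikhande factors alone. -/

/-- The homomorphism `p ↦ (T p, p z)`. -/
def twistHom {k : ℕ} (T : ZMod 4 × ZMod 4 →+ ZMod 4 × ZMod 4) (z : QuadVec k) :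
    ZMod 4 × ZMod 4 →+ (ZMod 4 × ZMod 4) × QuadVec k :=
  AddMonoidHom.mk' (fun p => (T p, QuadVec.smul (quadOfZMod4 p) z)) fun p q => by
    rw [map_add, map_add, QuadVec.add_smul]; rfl

/-- Each step `e` is nonzero modulo two, so `z ↦ e z` is a bijection and the second component takes
each value once. -/
lemma sum_twistHom {k : ℕ} (T : ZMod 4 × ZMod 4 →+ ZMod 4 × ZMod 4)
    (d : (ZMod 4 × ZMod 4) × QuadVec k) :
    (∑ z : QuadVec k, ∑ e ∈ shrikhandeSteps, if twistHom T z e = d then 1 else 0) =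
      ∑ e ∈ shrikhandeSteps, if T e = d.1 then 1 else 0 := by
  rw [sum_comm]
  refine sum_congr rfl fun e he => ?_
  have he' : quadOfZMod4 e ≠ 0 := by
    have : ∀ e ∈ shrikhandeSteps, quadOfZMod4 e ≠ 0 := by decide
    exact this e he
  obtain ⟨a, v⟩ := d
  by_cases h : T e = a
  · simpa [twistHom, h] using QuadVec.sum_smul_eq he' v
  · simp [twistHom, h]

/-- An automorphism carrying the connecting set of the Shrikhande graph onto the other elements
of order four. -/
def shrikhandeTwist : ZMod 4 × ZMod 4 →+ ZMod 4 × ZMod 4 :=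
  AddMonoidHom.mk' (fun p => (p.1 + p.2, 3 * p.1 + 2 * p.2)) fun p q => by
    ext <;> simp <;> ring

lemma hasCayleyColoring_orderFour (k : ℕ) :
    HasCayleyColoring (2 * 4 ^ k) 0
      (fun d : (ZMod 4 × ZMod 4) × QuadVec k => if quadOfZMod4 d.1 = 0 then 0 else 1) := by
  have key : ∀ T : ZMod 4 × ZMod 4 →+ ZMod 4 × ZMod 4, HasCayleyColoring (4 ^ k) 0
      (fun d : (ZMod 4 × ZMod 4) × QuadVec k =>
        ∑ e ∈ shrikhandeSteps, if T e = d.1 then 1 else 0) := fun T => by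
    have h := hasCayleyColoring_sum univ (fun _ : QuadVec k => 1) (fun _ => 0) _
      fun z _ => hasCayleyColoring_shrikhande (twistHom T z)
    convert h using 1
    · simp
    · simp
    · funext d
      rw [Finset.sum_apply, sum_twistHom]
  have hsum : ∀ a : ZMod 4 × ZMod 4,
      (∑ e ∈ shrikhandeSteps, if AddMonoidHom.id _ e = a then 1 else 0) +
        (∑ e ∈ shrikhandeSteps, if shrikhandeTwist e = a then 1 else 0) =
      if quadOfZMod4 a = 0 then 0 else 1 := by decide
  convert (key (AddMonoidHom.id _)).add (key shrikhandeTwist) using 1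
  · ring
  · funext d
    exact (hsum d.1).symm

/-- Digits to base two. -/
noncomputable def zmod4Digits : ZMod 4 × ZMod 4 ≃ Quad × Quad :=
  Equiv.ofBijective
    (fun p => (quadOfZMod4 p, (((p.1.val / 2 : ℕ) : ZMod 2), ((p.2.val / 2 : ℕ) : ZMod 2))))
    (by decide)

/-- Appending a coordinate. -/
def quadVecSuccEquiv (k : ℕ) : Quad × QuadVec k ≃ QuadVec (k + 1) :=
  Fin.consEquiv fun _ => Quad

/-! ### Uniform colorings with diagonal zero. -/

/-- The quotient matrix of a coloring by pairs in which exactly the steps that change the first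
component occur, each `g` times. -/
def multipartiteMatrix (k g : ℕ) (p q : Quad × QuadVec k) : ℕ := if p.1 = q.1 then 0 else g

/-- The matrix with diagonal entries `d` and all other entries `g`. -/
def uniformMatrix {X : Type*} [DecidableEq X] (d g : ℕ) (x y : X) : ℕ := if x = y then d else g

lemma hasEquitableColoring_multipartite (k g m n : ℕ) (h : 2 * m + n = g * 4 ^ k)
    (hg : Even g ∨ 4 ^ k ≤ n) : HasEquitableColoring m n (multipartiteMatrix k g) := by
  refine HasEquitableColoring.mono_eq (hasCayleyColoring_quadSteps k g m n h hg) rfl rfl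
    fun x y => ?_
  have e : (y - x).1 = 0 ↔ x.1 = y.1 := by rw [Prod.fst_sub, sub_eq_zero, eq_comm]
  simp [-Prod.fst_sub, quadSteps, multipartiteMatrix, e]

/-- The target matrix sees only the class modulo two, so the group structure of `ℤ₄²` may be
forgotten and its elements relabeled by their digits. -/
lemma hasEquitableColoring_multipartite_shrikhande (k g : ℕ) :
    HasEquitableColoring (2 * g * 4 ^ k) 0 (multipartiteMatrix (k + 1) g) := by
  have h := hasCayleyColoring_sum (range g) (fun _ => 2 * 4 ^ k) (fun _ => 0) _
    fun _ _ => hasCayleyColoring_orderFour k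
  have h' := HasEquitableColoring.congr_equiv (M' := multipartiteMatrix (k + 1) g) h
    (((zmod4Digits.prodCongr (Equiv.refl _)).trans (Equiv.prodAssoc _ _ _)).trans
      ((Equiv.refl _).prodCongr (quadVecSuccEquiv k))) fun x y => by
        have e : quadOfZMod4 (y - x).1 = 0 ↔ quadOfZMod4 x.1 = quadOfZMod4 y.1 := by
          rw [Prod.fst_sub, map_sub, sub_eq_zero, eq_comm]
        simp [-Prod.fst_sub, multipartiteMatrix, zmod4Digits, e]
  exact h'.mono_eq (by simp; ring) (by simp) fun _ _ => rfl

lemma hasEquitableColoring_succ {l d g m₁ n₁ m₂ n₂ : ℕ}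
    (h₁ : HasEquitableColoring m₁ n₁ (multipartiteMatrix l g))
    (h₂ : HasEquitableColoring m₂ n₂ (uniformMatrix (X := QuadVec l) d g)) :
    HasEquitableColoring (m₁ + m₂) (n₁ + n₂) (uniformMatrix (X := QuadVec (l + 1)) d g) := by
  have h : HasEquitableColoring (m₁ + m₂) (n₁ + n₂)
      (uniformMatrix (X := Quad × QuadVec l) d g) := by
    refine h₁.combine h₂ (fun p s => (p.1, p.2 + s)) fun ⟨i, a⟩ s ⟨j, z⟩ => ?_
    have e₁ : ∀ p : Quad × QuadVec l, ((p.1, p.2 + s) = (j, z)) ↔ p = (j, z - s) := fun ⟨i', a'⟩ => by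
      simp only [Prod.mk.injEq, eq_sub_iff_add_eq]
    have e₂ : ∀ s' : QuadVec l, ((i, a + s') = (j, z)) ↔ i = j ∧ s' = z - a := fun s' => by
      simp only [Prod.mk.injEq, eq_sub_iff_add_eq']
    simp only [e₁, e₂, Finset.sum_ite_eq', mem_univ, if_true]
    by_cases hij : i = j
    · simp only [hij, true_and, Finset.sum_ite_eq', mem_univ, if_true]
      simp [multipartiteMatrix, uniformMatrix, eq_sub_iff_add_eq']
    · simp [hij, multipartiteMatrix, uniformMatrix]
  refine h.congr_equiv (quadVecSuccEquiv l) fun x y => ?_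
  simp [uniformMatrix]

lemma hasEquitableColoring_zero (g : ℕ) :
    HasEquitableColoring 0 0 (uniformMatrix (X := QuadVec 0) 0 g) := by
  refine HasEquitableColoring.mono_eq (hasCayleyColoring_zero (A := QuadVec 0)) rfl rfl
    fun x y => ?_
  simp [uniformMatrix, Subsingleton.elim x y]

lemma hasEquitableColoring_uniform_zero (g : ℕ) (hg : 2 ≤ g) : ∀ l m n : ℕ,
    3 * (2 * m + n) + g = g * 4 ^ l →
      HasEquitableColoring m n (uniformMatrix (X := QuadVec l) 0 g)
  | 0, m, n, h => by
    obtain ⟨rfl, rfl⟩ : m = 0 ∧ n = 0 := by omega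
    exact hasEquitableColoring_zero g
  | l + 1, m, n, h => by
    have ih := hasEquitableColoring_uniform_zero g hg l
    have hpow : g * 4 ^ (l + 1) = 4 * (g * 4 ^ l) := by ring
    have hle : g ≤ g * 4 ^ l := Nat.le_mul_of_pos_right _ (by positivity)
    have hqle : 4 ^ l ≤ g * 4 ^ l := Nat.le_mul_of_pos_left _ (by omega)
    -- It suffices to split off suitable factors covered by `hasEquitableColoring_multipartite`.
    have split : ∀ n₁, n₁ ≤ n → n₁ ≤ g * 4 ^ l → Even (g * 4 ^ l - n₁) →
        g * 4 ^ l ≤ 2 * m + n₁ → (Even g ∨ 4 ^ l ≤ n₁) →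
        HasEquitableColoring m n (uniformMatrix (X := QuadVec (l + 1)) 0 g) := by
      rintro n₁ h₁ h₂ ⟨m₁, hm₁⟩ h₃ h₄
      have b₁ := hasEquitableColoring_multipartite l g m₁ n₁ (by omega) h₄
      have b₂ := ih (m - m₁) (n - n₁) (by omega)
      exact (hasEquitableColoring_succ b₁ b₂).mono_eq (by omega) (by omega) fun _ _ => rfl
    rcases Nat.even_or_odd g with he | ho
    · have hQ : Even (g * 4 ^ l) := he.mul_right _
      obtain ⟨a, ha⟩ := he
      obtain ⟨b, hb⟩ := hQ
      refine split (min n (g * 4 ^ l)) (by omega) (by omega) ?_ (by omega) (Or.inl ⟨a, ha⟩)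
      rw [Nat.even_iff]
      omega
    rcases l with _ | k
    · obtain ⟨a, ha⟩ := ho
      simp only [pow_zero, mul_one] at *
      refine split n le_rfl (by omega) ?_ (by omega) (Or.inr (by omega))
      rw [Nat.even_iff]
      omega
    have hk : g * 4 ^ (k + 1) = 4 * (g * 4 ^ k) := by ring
    have hk' : 4 ^ (k + 1) = 4 * 4 ^ k := by ring
    have hk₀ : g ≤ g * 4 ^ k := Nat.le_mul_of_pos_right _ (by positivity)
    -- Here `g ≥ 3` enters: if `n < 4 ^ (k + 1)`, this forces `m ≥ 2 * g * 4 ^ k`, enough Shrikhande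
    -- factors for the first group.
    have h3 : 3 * (4 ^ (k + 1) - 1) ≤ g * 4 ^ (k + 1) - g := by
      have := Nat.mul_le_mul_right (4 ^ (k + 1) - 1) (show 3 ≤ g by obtain ⟨a, ha⟩ := ho; omega)
      rwa [Nat.mul_sub g, mul_one] at this
    by_cases hn : n < 4 ^ (k + 1)
    · have b₁ := hasEquitableColoring_multipartite_shrikhande k g
      have b₂ := ih (m - 2 * g * 4 ^ k) n (by
        rw [mul_assoc]
        omega)
      refine (hasEquitableColoring_succ b₁ b₂).mono_eq ?_ (by omega) fun _ _ => rfl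
      rw [mul_assoc]
      omega
    · obtain ⟨a, ha⟩ := ho
      -- For odd `g` the number `2 * m + n` is odd, hence so is `n`; then `n - 1` is even and still
      -- at least `4 ^ (k + 1)`.
      refine split (min (n - 1) (g * 4 ^ (k + 1))) (by omega) (by omega) ?_ (by omega)
        (Or.inr (by omega))
      rw [Nat.even_iff]
      omega

/-! ### Uniform colorings with diagonal three. -/

/-- A coloring of the product of two Shrikhande graphs by the sign patterns of two commuting
eigenfunctions with eigenvalue zero whose product is such an eigenfunction too. -/
def shrikhandePairColoring (x y : ZMod 4 × ZMod 4) : Quad :=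
  ((if x.1.val < 2 then 0 else 1) + if y.2.val % 2 = 0 then 0 else 1,
    (if (x.1 + 1).val < 2 then 0 else 1) + if (y.1 + 2 * y.2).val < 2 then 0 else 1)

/-- The indicator of a color is a quarter of `1 ± u ± v ± uv`. Since `u`, `v`, `uv` have eigenvalue
zero, each color receives a quarter of the degree `12`. -/
lemma hasEquitableColoring_three :
    HasEquitableColoring 2 0 (fun _ _ : Quad => 3) := by
  refine ⟨fun v => shrikhandePairColoring (v.1 0) (v.1 1), fun v j => ?_⟩
  -- The coloring ignores the second coordinate of its first argument, so that coordinate may be set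
  -- to zero.
  have key : ∀ (a : ZMod 4) (y : ZMod 4 × ZMod 4) (j : Quad),
      (∑ e ∈ shrikhandeSteps,
        if shrikhandePairColoring ((a, 0) + e) y = j then 1 else 0) +
      (∑ e ∈ shrikhandeSteps, if shrikhandePairColoring (a, 0) (y + e) = j then 1 else 0) =
        3 := by decide +kernel
  have key' : (∑ e ∈ shrikhandeSteps,
        if shrikhandePairColoring (v.1 0 + e) (v.1 1) = j then 1 else 0) +
      (∑ e ∈ shrikhandeSteps,
        if shrikhandePairColoring (v.1 0) (v.1 1 + e) = j then 1 else 0) = 3 :=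
    key (v.1 0).1 (v.1 1) j
  rw [ncard_doobGraph_adj v (fun y => shrikhandePairColoring (y.1 0) (y.1 1) = j),
    Fin.sum_univ_two]
  simpa [ncard_shrikhandeGraph_adj] using key'

lemma hasEquitableColoring_uniform_three (g : ℕ) (hg : 2 ≤ g) (ho : Odd g) : ∀ l m : ℕ,
    3 * (2 * m) + g = g * 4 ^ (l + 1) + 3 →
      HasEquitableColoring m 0 (uniformMatrix (X := QuadVec (l + 1)) 3 g)
  | 0, m, h => by
    obtain ⟨a, ha⟩ := ho
    have b₁ := hasEquitableColoring_three
    -- The first two factors contribute `3` to every entry; the even remainder `g - 3` needs no `K₄`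
    -- factor.
    have b₂ := hasEquitableColoring_multipartite 0 (g - 3) (a - 1) 0 (by omega)
      (Or.inl (by rw [Nat.even_iff]; omega))
    have b : HasEquitableColoring (2 + (a - 1)) 0
        (uniformMatrix (X := Quad × QuadVec 0) 3 g) := by
      refine b₁.combine b₂ (fun i p => (i + p.1, p.2)) fun i ⟨j, u⟩ ⟨k, w⟩ => ?_
      have huw : u = w := Subsingleton.elim _ _
      subst huw
      have e₁ : ∀ i' : Quad, (i' + j, u) = (k, u) ↔ i' = k - j := fun i' => by
        simp only [Prod.mk.injEq, and_true, eq_sub_iff_add_eq]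
      have e₂ : ∀ p : Quad × QuadVec 0, (i + p.1, p.2) = (k, u) ↔ p = (k - i, u) :=
        fun ⟨i', a'⟩ => by
          simp only [Prod.mk.injEq, eq_sub_iff_add_eq']
      simp only [e₁, e₂, Finset.sum_ite_eq', mem_univ, if_true, multipartiteMatrix,
        uniformMatrix]
      simp only [eq_sub_iff_add_eq', add_comm j i]
      split_ifs <;> omega
    refine HasEquitableColoring.mono_eq (M := uniformMatrix (X := QuadVec 1) 3 g)
      (b.congr_equiv (quadVecSuccEquiv 0) fun x y => ?_) (by omega) rfl fun _ _ => rfl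
    simp [uniformMatrix]
  | l + 1, m, h => by
    have hpow : g * 4 ^ (l + 1 + 1) = 16 * (g * 4 ^ l) := by ring
    have hpow' : g * 4 ^ (l + 1) = 4 * (g * 4 ^ l) := by ring
    have hle : g ≤ g * 4 ^ l := Nat.le_mul_of_pos_right _ (by positivity)
    have b₁ := hasEquitableColoring_multipartite_shrikhande l g
    have b₂ := hasEquitableColoring_uniform_three g hg ho l (m - 2 * g * 4 ^ l) (by
      rw [mul_assoc]
      omega)
    refine (hasEquitableColoring_succ b₁ b₂).mono_eq ?_ rfl fun _ _ => rfl
    rw [mul_assoc]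
    omega

/-! ### Merging colors. -/

lemma sum_uniformMatrix {X : Type*} [Fintype X] [DecidableEq X] (d g : ℕ) (x : X)
    (P : X → Prop) [DecidablePred P] :
    (∑ y, if P y then uniformMatrix d g x y else 0) =
      if P x then g * (#{y | P y} - 1) + d else g * #{y | P y} := by
  rw [← sum_filter]
  split_ifs with h
  · have hx : x ∈ ({y | P y} : Finset X) := by simpa using h
    rw [← sum_erase_add _ _ hx, sum_congr rfl (g := fun _ => g), sum_const, card_erase_of_mem hx]
    · simp [uniformMatrix, mul_comm]
    · intro y hy
      exact if_neg (ne_of_mem_erase hy).symm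
  · rw [sum_congr rfl (g := fun _ => g), sum_const, smul_eq_mul, mul_comm]
    intro y hy
    refine if_neg ?_
    rintro rfl
    exact h (by simpa using hy)

/-- Merging `p` and `q` of the colors of a uniform coloring by `p + q` colors. -/
lemma HasEquitableColoring.exists_isPerfectColoring {l m n d g p q : ℕ}
    (h : HasEquitableColoring m n (uniformMatrix (X := QuadVec l) d g))
    (hpq : p + q = 4 ^ l) (hp : 0 < p) (hq : 0 < q) (hg : 0 < g) :
    ∃ f : DoobVertex m n → Fin 2, IsPerfectColoring (doobGraph m n) f
      !![g * (p - 1) + d, g * q; g * p, g * (q - 1) + d] := by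
  obtain ⟨f, hf⟩ := h
  let e : QuadVec l ≃ Fin (4 ^ l) := Fintype.equivFinOfCardEq (QuadVec.card l)
  let color : QuadVec l → Fin 2 := fun x => if (e x).val < p then 0 else 1
  have hc₀ : #{x | color x = 0} = p := by
    have : #{x | color x = 0} = #{i : Fin (4 ^ l) | i.val < p} :=
      card_equiv e fun x => by simp [color]
    rw [this, Fin.card_filter_val_lt]
    omega
  have hc₁ : #{x | color x = 1} = q := by
    have h1 := card_filter_add_card_filter_not (s := (univ : Finset (QuadVec l)))
      (fun x => color x = 0)
    have h2 : ∀ x, ¬ color x = 0 ↔ color x = 1 := fun x => by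
      generalize color x = c
      revert c
      decide
    simp only [h2] at h1
    rw [hc₀, card_univ, QuadVec.card] at h1
    omega
  have count : ∀ (j : Fin 2) (v : DoobVertex m n),
      {y | (doobGraph m n).Adj v y ∧ color (f y) = j}.ncard =
        if color (f v) = j then g * (#{x | color x = j} - 1) + d
          else g * #{x | color x = j} := fun j v => by
    rw [ncard_adj_and_comp _ f v (fun x => color x = j)]
    simp only [hf]
    exact sum_uniformMatrix d g (f v) fun x => color x = j
  have hpos : ∀ j, 0 < #{x | color x = j} := by
    intro j
    fin_cases j
    · simpa [hc₀] using hp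
    · simpa [hc₁] using hq
  refine ⟨fun v => color (f v), fun j => ?_, ?_⟩
  · let v₀ : DoobVertex m n := (fun _ => 0, fun _ => 0)
    by_cases h0 : color (f v₀) = j
    · exact ⟨v₀, h0⟩
    · have := count j v₀
      rw [if_neg h0] at this
      have hne : {y | (doobGraph m n).Adj v₀ y ∧ color (f y) = j}.Nonempty := by
        rw [← Set.ncard_pos, this]
        exact Nat.mul_pos hg (hpos j)
      obtain ⟨y, -, hy⟩ := hne
      exact ⟨y, hy⟩
  · intro i j v hv
    rw [count j v]
    simp only at hv
    rw [hv]
    fin_cases i <;> fin_cases j <;> simp [hc₀, hc₁]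

theorem mainTheorem5 (b c l : ℕ) (hb : 0 < b) (hc : 0 < c) (hg : 2 ≤ Nat.gcd b c)
    (hbc : (b + c) / Nat.gcd b c = 4 ^ l) :
    (∀ m n : ℕ, 2 * m + n = Nat.gcd b c * (4 ^ l - 1) / 3 →
      ∃ f : (Fin m → ZMod 4 × ZMod 4) × (Fin n → ZMod 4) → Fin 2,
        IsPerfectColoring (doobGraph m n) f
          !![c - Nat.gcd b c, b;
             c, b - Nat.gcd b c]) ∧
    (Odd (Nat.gcd b c) →
      ∃ m : ℕ, 2 * m = (Nat.gcd b c * (4 ^ l - 1) + 3) / 3 ∧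
        ∃ f : (Fin m → ZMod 4 × ZMod 4) × (Fin 0 → ZMod 4) → Fin 2,
          IsPerfectColoring (doobGraph m 0) f
            !![c - Nat.gcd b c + 3, b;
               c, b - Nat.gcd b c + 3]) := by
  obtain ⟨q, hq⟩ := Nat.gcd_dvd_left b c
  obtain ⟨p, hp⟩ := Nat.gcd_dvd_right b c
  generalize Nat.gcd b c = g at *
  subst hq hp
  have hg₀ : 0 < g := by omega
  have hq₀ : 0 < q := Nat.pos_of_mul_pos_left hb
  have hp₀ : 0 < p := Nat.pos_of_mul_pos_left hc
  have hpq : p + q = 4 ^ l := by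
    rw [← hbc, ← mul_add, Nat.mul_div_cancel_left _ hg₀, add_comm]
  have hsub : ∀ x, g * x - g = g * (x - 1) := fun x => by rw [Nat.mul_sub, mul_one]
  obtain ⟨t, ht⟩ : 3 ∣ 4 ^ l - 1 := by simpa using Nat.sub_dvd_pow_sub_pow 4 1 l
  have hpow : 4 ^ l = 3 * t + 1 := by have : 0 < 4 ^ l := by positivity
                                      omega
  have hgt : g * (4 ^ l - 1) = 3 * (g * t) := by rw [ht]; ring
  have hgl : g * 4 ^ l = 3 * (g * t) + g := by rw [hpow]; ring
  rw [hgt, hsub, hsub]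
  constructor
  · intro m n h
    have := hasEquitableColoring_uniform_zero g hg l m n (by omega)
    simpa using this.exists_isPerfectColoring hpq hp₀ hq₀ hg₀
  · intro ho
    rcases l with _ | l
    · simp at hpq
      omega
    -- Now `3 * t + 1` is a positive power of four, so `t` is odd.
    have hodd : Odd (g * t) := ho.mul (by
      rw [Nat.odd_iff]
      rw [pow_succ] at hpow
      omega)
    obtain ⟨a, ha⟩ := hodd
    refine ⟨a + 1, by omega, ?_⟩
    have := hasEquitableColoring_uniform_three g hg ho l (a + 1) (by omega)
    exact this.exists_isPerfectColoring hpq hp₀ hq₀ hg₀
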